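/- Let $\Gamma$ be a countable discrete group which is icc, i.e. $\Gamma$ is infinite and every conjugacy class of $\Gamma$ other than $\{1\}$ is infinite. Let $\lambda_\Gamma$ be the left regular representation of $\Gamma$ on $\ell^2(\Gamma)$, given by $(\lambda_\Gamma(g)\xi)(x)=\xi(g^{-1}x)$. Then $\lambda_\Gamma$ is reducible: there is a closed $\lambda_\Gamma(\Gamma)$-invariant subspace of $\ell^2(\Gamma)$ other than $\{0\}$ and $\ell^2(\Gamma)$. Moreover, $\lambda_\Gamma$ is weakly equivalent to an irreducible representation: there exist a nonzero complex Hilbert space $\mathcal H$ and a unitary representation $\pi$ of $\Gamma$ on $\mathcal H$, whose only closed invariant subspaces are $\{0\}$ and $\mathcal H$, such that $\lambda_\Gamma\prec\pi$ and $\pi\prec\lambda_\Gamma$. Here, for unitary representations $\rho,\sigma$ of $\Gamma$, one writes $\rho\prec\sigma$ ($\rho$ is weakly contained in $\sigma$) if every diagonal matrix coefficient $g\mapsto\langle\xi\mid\rho(g)\xi\rangle$ of $\rho$ is a limit, uniformly on finite subsets of $\Gamma$, of finite sums of diagonal matrix coefficients of $\sigma$. -/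

import Mathlib

universe u

open scoped ENNReal

/-- A group is icc if it is infinite and if every conjugacy class other than that of `1` is
infinite. -/
def IsICC (Γ : Type*) [Group Γ] : Prop :=
  Infinite Γ ∧ ∀ g : Γ, g ≠ 1 → (conjugatesOf g).Infinite

/-- A unitary representation of the discrete group `Γ` in `H`: a homomorphism into the group of
surjective linear isometries of `H`. It is used for complex Hilbert spaces `H` only. Continuity of
`Γ × H → H` is automatic because `Γ` is discrete. -/
abbrev UnitaryRepr (Γ : Type*) [Group Γ] (H : Type*) [NormedAddCommGroup H]
    [InnerProductSpace ℂ H] :=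
  Γ →* (H ≃ₗᵢ[ℂ] H)

namespace UnitaryRepr

variable {Γ : Type*} [Group Γ]
variable {H : Type*} [NormedAddCommGroup H] [InnerProductSpace ℂ H]
variable {K : Type*} [NormedAddCommGroup K] [InnerProductSpace ℂ K]

/-- The diagonal matrix coefficient `g ↦ ⟨ξ | ρ(g) ξ⟩`. -/
noncomputable def diagCoeff (ρ : UnitaryRepr Γ H) (ξ : H) (g : Γ) : ℂ :=
  inner ℂ ξ (ρ g ξ)

/-- A subspace that is mapped into itself by all operators of the representation. -/
def IsInvariant (ρ : UnitaryRepr Γ H) (V : Submodule ℂ H) : Prop :=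
  ∀ g : Γ, ∀ ξ ∈ V, ρ g ξ ∈ V

/-- Reducible: there is a closed invariant subspace other than `0` and the whole space. -/
def IsReducible (ρ : UnitaryRepr Γ H) : Prop :=
  ∃ V : Submodule ℂ H, IsClosed (V : Set H) ∧ IsInvariant ρ V ∧ V ≠ ⊥ ∧ V ≠ ⊤

/-- Irreducible: the space is nonzero, and `0` and the whole space are the only closed invariant
subspaces. -/
def IsIrreducible (ρ : UnitaryRepr Γ H) : Prop :=
  Nontrivial H ∧
    ∀ V : Submodule ℂ H, IsClosed (V : Set H) → IsInvariant ρ V → V = ⊥ ∨ V = ⊤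

/-- `ρ` is weakly contained in `σ`: every diagonal matrix coefficient of `ρ` is a limit of finite
sums of diagonal matrix coefficients of `σ`, uniformly on the compact (that is, finite) subsets of
the discrete group `Γ`. -/
def WeaklyContained (ρ : UnitaryRepr Γ H) (σ : UnitaryRepr Γ K) : Prop :=
  ∀ ξ : H, ∀ F : Finset Γ, ∀ ε : ℝ, 0 < ε →
    ∃ (n : ℕ) (η : Fin n → K),
      ∀ g ∈ F, ‖diagCoeff ρ ξ g - ∑ i, diagCoeff σ (η i) g‖ < ε

/-- Weak equivalence: weak containment in both directions. -/
def WeaklyEquivalent (ρ : UnitaryRepr Γ H) (σ : UnitaryRepr Γ K) : Prop :=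
  WeaklyContained ρ σ ∧ WeaklyContained σ ρ

end UnitaryRepr

section LeftRegular

variable {Γ : Type*} [Group Γ]

/-- The Hilbert space `ℓ²(Γ)` of square-summable complex functions on `Γ`, that is, `L²(Γ)` for
the counting measure. -/
noncomputable abbrev EllTwo (Γ : Type*) := lp (fun _ : Γ => ℂ) 2

theorem memℓp_two_leftTranslate (g : Γ) (ξ : EllTwo Γ) :
    Memℓp (fun x : Γ => ξ (g⁻¹ * x)) 2 := by
  have h := (memℓp_gen_iff (by norm_num)).1 (lp.memℓp ξ)
  exact memℓp_gen (h.comp_injective (mul_right_injective g⁻¹))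

/-- Left translation `ξ ↦ (x ↦ ξ (g⁻¹ x))` on `ℓ²(Γ)`. -/
noncomputable def leftTranslate (g : Γ) (ξ : EllTwo Γ) : EllTwo Γ :=
  ⟨fun x => ξ (g⁻¹ * x), memℓp_two_leftTranslate g ξ⟩

theorem leftTranslate_apply (g : Γ) (ξ : EllTwo Γ) (x : Γ) :
    leftTranslate g ξ x = ξ (g⁻¹ * x) := rfl

theorem leftTranslate_one (ξ : EllTwo Γ) : leftTranslate 1 ξ = ξ := by
  ext x
  simp [leftTranslate_apply]

theorem leftTranslate_mul (g h : Γ) (ξ : EllTwo Γ) :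
    leftTranslate (g * h) ξ = leftTranslate g (leftTranslate h ξ) := by
  ext x
  simp [leftTranslate_apply, mul_assoc]

theorem norm_leftTranslate (g : Γ) (ξ : EllTwo Γ) : ‖leftTranslate g ξ‖ = ‖ξ‖ := by
  rw [lp.norm_eq_tsum_rpow (by norm_num), lp.norm_eq_tsum_rpow (by norm_num)]
  congr 1
  exact (Equiv.mulLeft g⁻¹).tsum_eq (fun x => ‖ξ x‖ ^ (2 : ℝ≥0∞).toReal)

/-- Left translation by `g` as a surjective linear isometry of `ℓ²(Γ)`. -/
noncomputable def leftTranslateIsometry (g : Γ) : EllTwo Γ ≃ₗᵢ[ℂ] EllTwo Γ where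
  toFun := leftTranslate g
  invFun := leftTranslate g⁻¹
  left_inv ξ := by rw [← leftTranslate_mul, inv_mul_cancel, leftTranslate_one]
  right_inv ξ := by rw [← leftTranslate_mul, mul_inv_cancel, leftTranslate_one]
  map_add' _ _ := rfl
  map_smul' _ _ := rfl
  norm_map' := norm_leftTranslate g

/-- The left regular representation `λ_Γ` of `Γ` on `ℓ²(Γ)`, `(λ_Γ(g) ξ)(x) = ξ(g⁻¹ x)`. -/
noncomputable def leftRegularRepr (Γ : Type*) [Group Γ] : UnitaryRepr Γ (EllTwo Γ) where
  toFun := leftTranslateIsometry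
  map_one' := LinearIsometryEquiv.ext leftTranslate_one
  map_mul' g h := LinearIsometryEquiv.ext (leftTranslate_mul g h)

theorem leftRegularRepr_apply (g : Γ) (ξ : EllTwo Γ) (x : Γ) :
    leftRegularRepr Γ g ξ x = ξ (g⁻¹ * x) := rfl

end LeftRegular

/-! Right translations commute with the left regular representation. Reducibility follows because `R
g + R g⁻¹` is self-adjoint and indefinite, so its positive part has a proper nonzero kernel
(`isReducible_leftRegularRepr`).

For the irreducible representation, let `A` be the reduced C⋆-algebra. It is separable, and it is
prime (`IsICC.exists_apply_ne_zero`): an icc group has no proper nonzero closed subspace of `ℓ²(Γ)`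
invariant under both translations, because projecting the point mass at `1` onto such a subspace
gives a square-summable function that is constant on conjugacy classes.

A separable prime C⋆-algebra has a faithful irreducible representation
(`exists_injective_irreducible_of_prime`). The kernel must avoid countably many test elements `h n`.
Primeness yields a decreasing sequence of positive norm-one `b n`, each in `A (h n) A`, and an
extreme point of the set of states equal to `1` on every `b n` is a pure state whose GNS
representation kills no `h n`.

Faithful representations preserve spectra, hence positivity; a Hahn–Banach separation turns this
into weak equivalence (`UnitaryRepr.weaklyContained_of_injective`). -/

open scoped ComplexOrder

/-! ### Norm-one functionals and positivity. -/

section States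

variable {A : Type*} [CStarAlgebra A] [Nontrivial A]

theorem im_apply_eq_zero_of_isSelfAdjoint {ψ : A →L[ℂ] ℂ} (hψ : ‖ψ‖ ≤ 1) (h1 : ψ 1 = 1) {a : A}
    (ha : IsSelfAdjoint a) : (ψ a).im = 0 := by
  -- Compare `|ψ (a + it)|²` with `‖a + it‖² ≤ ‖a‖² + t²`: the terms `t²` cancel, and a bound linear
  -- in `t` for all real `t` forces the imaginary part to vanish.
  have key : ∀ t : ℝ, 2 * t * (ψ a).im ≤ ‖a‖ ^ 2 * ‖(1 : A)‖ := by
    intro t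
    set x : A := a + ((t : ℂ) * Complex.I) • (1 : A) with hx
    have hxx : star x * x = a * a + ((t : ℂ) ^ 2) • (1 : A) := by
      have : star x = a - ((t : ℂ) * Complex.I) • (1 : A) := by
        simp [hx, ha.star_eq, sub_eq_add_neg]
      rw [this, hx]
      have hI : ((t : ℂ) * Complex.I) * ((t : ℂ) * Complex.I) = -(t : ℂ) ^ 2 := by
        ring_nf; simp
      simp only [sub_mul, mul_add, mul_one, mul_smul_comm, smul_mul_assoc, one_mul, smul_sub,
        smul_smul, hI, neg_smul]
      abel
    have hnorm : ‖x‖ ^ 2 ≤ ‖a‖ ^ 2 + t ^ 2 := by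
      rw [sq, ← CStarRing.norm_star_mul_self, hxx]
      refine (norm_add_le _ _).trans ?_
      gcongr
      · rw [sq]; exact norm_mul_le _ _
      · rw [norm_smul]; simp
    have hψx : ‖ψ x‖ ≤ ‖x‖ := (ψ.le_opNorm x).trans (mul_le_of_le_one_left (norm_nonneg _) hψ)
    have him : (ψ x).im = (ψ a).im + t := by simp [hx, h1]
    have h2 : ((ψ a).im + t) ^ 2 ≤ ‖a‖ ^ 2 + t ^ 2 := by
      rw [← him, ← sq_abs]
      exact (pow_le_pow_left₀ (abs_nonneg _) ((Complex.abs_im_le_norm _).trans hψx) 2).trans hnorm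
    have h3 : 1 ≤ ‖(1 : A)‖ := by
      simp
    nlinarith [sq_nonneg (ψ a).im, mul_le_mul_of_nonneg_left h3 (sq_nonneg ‖a‖)]
  by_contra h
  have := key ((‖a‖ ^ 2 * ‖(1 : A)‖ + 1) / (2 * (ψ a).im))
  rw [mul_assoc, mul_comm (_ / _), ← mul_assoc, mul_div_cancel₀ _ (by simpa using h)] at this
  linarith

variable [PartialOrder A] [StarOrderedRing A]

/-- A functional of norm at most `1` with value `1` at the unit is positive. -/
theorem apply_nonneg_of_norm_le_one {ψ : A →L[ℂ] ℂ} (hψ : ‖ψ‖ ≤ 1) (h1 : ψ 1 = 1) {a : A}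
    (ha : 0 ≤ a) : 0 ≤ ψ a := by
  rw [Complex.nonneg_iff]
  refine ⟨?_, (im_apply_eq_zero_of_isSelfAdjoint hψ h1 (.of_nonneg ha)).symm⟩
  wlog hn : ‖a‖ ≤ 1 generalizing a
  · have hpos : 0 < ‖a‖ := by linarith
    have := this (a := (‖a‖⁻¹ : ℝ) • a) (smul_nonneg (by positivity) ha)
      (by rw [norm_smul]; simp [hpos.ne'])
    rw [← Complex.coe_smul, map_smul, smul_eq_mul, Complex.re_ofReal_mul] at this
    exact nonneg_of_mul_nonneg_right this (by positivity)
  have h : ‖1 - a‖ ≤ 1 := by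
    rw [CStarAlgebra.norm_le_one_iff_of_nonneg a ha] at hn
    rw [CStarAlgebra.norm_le_one_iff_of_nonneg (1 - a) (sub_nonneg.2 hn)]
    simpa using ha
  have h' : ‖ψ (1 - a)‖ ≤ 1 := (ψ.le_opNorm _).trans (mul_le_one₀ hψ (norm_nonneg _) h)
  have := (Complex.re_le_norm _).trans h'
  simp [h1] at this
  exact this

/-- Since `1 - (2b - 1)² = 4b(1 - b) ≥ 0`, the element `2b - 1` is a contraction. So `ψ 1` lies in
the closed unit disc and in the closed unit disc about `2`, which meet only at `1`. -/
theorem apply_one_of_apply_eq_one {ψ : A →L[ℂ] ℂ} (hψ : ‖ψ‖ ≤ 1) {b : A} (hb : 0 ≤ b)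
    (hb1 : ‖b‖ ≤ 1) (h : ψ b = 1) : ψ 1 = 1 := by
  have hb' := (CStarAlgebra.norm_le_one_iff_of_nonneg b hb).1 hb1
  have h1 : ‖ψ 1‖ ≤ 1 := (ψ.le_opNorm _).trans (mul_le_one₀ hψ (norm_nonneg _) CStarRing.norm_one.le)
  have hsq : star (b + b - 1) * (b + b - 1) ≤ 1 := by
    have : 0 ≤ b * (1 - b) := Commute.mul_nonneg hb (sub_nonneg.2 hb')
      ((Commute.one_right b).sub_right (Commute.refl b))
    have hs : star (b + b - 1) = b + b - 1 := by simp [(IsSelfAdjoint.of_nonneg hb).star_eq]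
    have h4 : 1 - star (b + b - 1) * (b + b - 1) =
        b * (1 - b) + b * (1 - b) + b * (1 - b) + b * (1 - b) := by
      rw [hs]; noncomm_ring
    rw [← sub_nonneg, h4]
    positivity
  have h2 : ‖b + b - 1‖ ≤ 1 := by
    rw [← CStarAlgebra.norm_le_one_iff_of_nonneg _ (star_mul_self_nonneg _),
      CStarRing.norm_star_mul_self] at hsq
    nlinarith [norm_nonneg (b + b - 1)]
  have h3 : ‖ψ (b + b - 1)‖ ≤ 1 := (ψ.le_opNorm _).trans (mul_le_one₀ hψ (norm_nonneg _) h2)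
  simp only [map_sub, map_add, h] at h3
  have e1 : (ψ 1).re ≤ 1 := (Complex.re_le_norm _).trans h1
  have e2 := (Complex.re_le_norm _).trans h3
  simp at e2
  have e3 : (ψ 1).re = 1 := by linarith
  have e4 : (ψ 1).im = 0 := by
    have := Complex.sq_norm (ψ 1)
    rw [Complex.normSq_apply, e3] at this
    nlinarith [norm_nonneg (ψ 1)]
  exact Complex.ext e3 e4

end States

/-! ### Decreasing bumps in a prime C⋆-algebra and the states they support. -/

section Bump

variable {A : Type*} [CStarAlgebra A] [PartialOrder A] [StarOrderedRing A]

/-- In a prime C⋆-algebra, nonzero `c` and `h` admit a positive `b` of norm `1` in `c A ∩ A h A`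
that acts as a unit on some nonzero element. -/
theorem exists_bump_of_prime (hA : ∀ a b : A, a ≠ 0 → b ≠ 0 → ∃ x, a * x * b ≠ 0) {c h : A}
    (hc : c ≠ 0) (hh : h ≠ 0) :
    ∃ b c' : A, 0 ≤ b ∧ ‖b‖ = 1 ∧ c' ≠ 0 ∧ b * c' = c' ∧ (∃ w, b = c * w) ∧
      ∃ u v, b = u * h * v := by
  have : Nontrivial A := ⟨c, 0, hc⟩
  obtain ⟨x, hx⟩ := hA c h hc hh
  set z := c * x * h with hz
  have hz0 : 0 < ‖z‖ := norm_pos_iff.2 hx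
  set y : A := ((‖z‖ ^ 2)⁻¹ : ℝ) • (z * star z) with hy
  have hy0 : 0 ≤ y := smul_nonneg (by positivity) (mul_star_self_nonneg z)
  have hy1 : ‖y‖ = 1 := by
    rw [hy, norm_smul, CStarRing.norm_self_mul_star, ← sq, Real.norm_of_nonneg (by positivity)]
    field_simp
  have hsa : IsSelfAdjoint y := .of_nonneg hy0
  -- `F t = min (2t) 1` equals `1` where `G` is nonzero, hence `F G = G`. Writing `F t = t * k t`
  -- keeps a factor `y`, a multiple of `c x h (c x h)⋆`, so `F(y)` lies in both `c A` and `A h A`.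
  -- Also `G(y) ≠ 0`, because `1 = ‖y‖` is in the spectrum and `G 1 = 1/2`.
  let k : ℝ → ℝ := fun t => (max t (1 / 2))⁻¹
  have hk : Continuous k :=
    Continuous.inv₀ (by fun_prop) fun t => (lt_max_of_lt_right (by norm_num)).ne'
  let F : ℝ → ℝ := fun t => t * k t
  have hF : Continuous F := continuous_id.mul hk
  let G : ℝ → ℝ := fun t => max (t - 1 / 2) 0
  have hG : Continuous G := by fun_prop
  have hspec : ∀ t ∈ spectrum ℝ y, 0 ≤ t := fun t ht => spectrum_nonneg_of_nonneg hy0 ht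
  have hb : cfc F y = y * cfc k y := by
    rw [cfc_mul (fun t => t) k y continuousOn_id hk.continuousOn, cfc_id' ℝ y]
  have hb0 : 0 ≤ cfc F y := cfc_nonneg fun t ht =>
    mul_nonneg (hspec t ht) (inv_nonneg.2 (le_max_of_le_left (hspec t ht)))
  have hble : ‖cfc F y‖ ≤ 1 := norm_cfc_le zero_le_one fun t ht => by
    have h0 := hspec t ht
    have h1 : 0 < max t (1 / 2) := lt_max_of_lt_right (by norm_num)
    rw [Real.norm_of_nonneg (mul_nonneg h0 (inv_nonneg.2 h1.le))]
    change t * (max t (1 / 2))⁻¹ ≤ 1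
    rw [← div_eq_mul_inv, div_le_one h1]
    exact le_max_left _ _
  have hc' : cfc G y ≠ 0 := by
    intro h0
    rw [← cfc_zero ℝ y, cfc_eq_cfc_iff_eqOn hsa hG.continuousOn continuous_zero.continuousOn] at h0
    have := h0 (CStarAlgebra.norm_mem_spectrum_of_nonneg hy0)
    simp [hy1, G] at this
    norm_num at this
  have hbc : cfc F y * cfc G y = cfc G y := by
    rw [← cfc_mul F G y hF.continuousOn hG.continuousOn]
    congr 1
    ext t
    change t * (max t (1 / 2))⁻¹ * max (t - 1 / 2) 0 = max (t - 1 / 2) 0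
    rcases le_total t (1 / 2) with ht | ht
    · rw [max_eq_right (sub_nonpos.2 ht), mul_zero]
    · rw [max_eq_left ht, mul_inv_cancel₀ (by linarith), one_mul]
  refine ⟨cfc F y, cfc G y, hb0, le_antisymm hble ?_, hc', hbc, ?_, ?_⟩
  · have := norm_mul_le (cfc F y) (cfc G y)
    rw [hbc] at this
    exact le_of_mul_le_mul_right (by simpa using this) (norm_pos_iff.2 hc')
  · refine ⟨x * h * (((‖z‖ ^ 2)⁻¹ : ℝ) • (star z * cfc k y)), ?_⟩
    rw [hb, hy]
    simp only [hz, mul_smul_comm, smul_mul_assoc, mul_assoc]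
  · refine ⟨c * x, ((‖z‖ ^ 2)⁻¹ : ℝ) • (star z * cfc k y), ?_⟩
    rw [hb, hy]
    simp only [hz, mul_smul_comm, smul_mul_assoc, mul_assoc]

/-- Each new bump is taken in `c A`, where `c` is the nonzero element fixed by the previous bump;
the previous bump therefore acts on it as a unit. -/
theorem exists_bump_seq_of_prime (hA : ∀ a b : A, a ≠ 0 → b ≠ 0 → ∃ x, a * x * b ≠ 0)
    (h : ℕ → A) (hh : ∀ n, h n ≠ 0) :
    ∃ b : ℕ → A, (∀ n, 0 ≤ b n) ∧ (∀ n, ‖b n‖ = 1) ∧ (∀ n, b n * b (n + 1) = b (n + 1)) ∧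
      ∀ n, ∃ u v, b n = u * h n * v := by
  let S := {p : A × A // 0 ≤ p.1 ∧ ‖p.1‖ = 1 ∧ p.2 ≠ 0 ∧ p.1 * p.2 = p.2}
  have step : ∀ (c : A) (_ : c ≠ 0) (n : ℕ), ∃ s : S,
      (∃ w, s.1.1 = c * w) ∧ ∃ u v, s.1.1 = u * h n * v := by
    intro c hc n
    obtain ⟨b, c', h1, h2, h3, h4, h5, h6⟩ := exists_bump_of_prime hA hc (hh n)
    exact ⟨⟨(b, c'), h1, h2, h3, h4⟩, h5, h6⟩
  choose f hf using step
  let s : ℕ → S := fun n => Nat.rec (f (h 0) (hh 0) 0) (fun n s => f s.1.2 s.2.2.2.1 (n + 1)) n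
  have hs : ∀ n, s (n + 1) = f (s n).1.2 (s n).2.2.2.1 (n + 1) := fun n => rfl
  refine ⟨fun n => (s n).1.1, fun n => (s n).2.1, fun n => (s n).2.2.1, fun n => ?_, fun n => ?_⟩
  · obtain ⟨w, hw⟩ := (hf (s n).1.2 (s n).2.2.2.1 (n + 1)).1
    simp only [hs]
    rw [hw, ← mul_assoc, (s n).2.2.2.2]
  · cases n with
    | zero => exact (hf (h 0) (hh 0) 0).2
    | succ n => exact (hf (s n).1.2 (s n).2.2.2.1 (n + 1)).2

/-- Dual functionals of norm at most `1` that take the value `1` on every term of the sequence. -/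
def supportFace (b : ℕ → A) : Set (WeakDual ℂ A) :=
  {ψ | ‖WeakDual.toStrongDual ψ‖ ≤ 1 ∧ ∀ n, ψ (b n) = 1}

/-- The conditions `ψ (b n) = 1` cut out weak-⋆ compact sets, each nonempty by Hahn–Banach and
decreasing because `b (n + 1) ≤ b n ≤ 1`. Their intersection is nonempty and compact, so
Krein–Milman applies. -/
theorem exists_extremePoint_supportFace [Nontrivial A] {b : ℕ → A} (h0 : ∀ n, 0 ≤ b n)
    (h1 : ∀ n, ‖b n‖ = 1) (hb : ∀ n, b n * b (n + 1) = b (n + 1)) :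
    (Set.extremePoints ℝ (supportFace b)).Nonempty := by
  have hlc : LocallyConvexSpace ℝ (WeakDual ℂ A) :=
    inferInstanceAs (LocallyConvexSpace ℝ (WeakBilin (topDualPairing ℂ A)))
  let B : Set (WeakDual ℂ A) := WeakDual.toStrongDual ⁻¹' Metric.closedBall 0 1
  have hB : IsCompact B := WeakDual.isCompact_closedBall 0 1
  have hBm : ∀ ψ, ψ ∈ B ↔ ‖WeakDual.toStrongDual ψ‖ ≤ 1 := fun ψ => by simp [B]
  let t : ℕ → Set (WeakDual ℂ A) := fun n => B ∩ {ψ | ψ (b n) = 1}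
  have hcl : ∀ n, IsClosed {ψ : WeakDual ℂ A | ψ (b n) = 1} := fun n =>
    isClosed_eq (WeakDual.eval_continuous (b n)) continuous_const
  have hmono : ∀ n, t (n + 1) ⊆ t n := by
    rintro n ψ ⟨hψ, h⟩
    refine ⟨hψ, ?_⟩
    rw [hBm] at hψ
    have hone := apply_one_of_apply_eq_one hψ (h0 (n + 1)) (h1 (n + 1)).le h
    have hcomm : b (n + 1) * b n = b (n + 1) := by
      have := congrArg star (hb n)
      rwa [star_mul, (IsSelfAdjoint.of_nonneg (h0 _)).star_eq,
        (IsSelfAdjoint.of_nonneg (h0 _)).star_eq] at this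
    have hle : b (n + 1) ≤ b n := by
      have : b n - b (n + 1) = b n * (1 - b (n + 1)) := by rw [mul_sub, mul_one, hb]
      rw [← sub_nonneg, this]
      refine Commute.mul_nonneg (h0 n) (sub_nonneg.2
        ((CStarAlgebra.norm_le_one_iff_of_nonneg _ (h0 _)).1 (h1 _).le)) ?_
      exact (Commute.one_right _).sub_right ((hb n).trans hcomm.symm)
    have hpos := apply_nonneg_of_norm_le_one hψ hone (sub_nonneg.2 hle)
    have h' : (WeakDual.toStrongDual ψ) (b (n + 1)) = 1 := h
    rw [map_sub, h', sub_nonneg] at hpos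
    refine le_antisymm ?_ hpos
    have hpos' := apply_nonneg_of_norm_le_one hψ hone (sub_nonneg.2
        ((CStarAlgebra.norm_le_one_iff_of_nonneg _ (h0 n)).1 (h1 n).le))
    rwa [map_sub, hone, sub_nonneg] at hpos'
  have hne : ∀ n, (t n).Nonempty := by
    intro n
    obtain ⟨g, hg, hgb⟩ := exists_dual_vector ℂ (b n) (by rw [h1]; exact one_ne_zero)
    refine ⟨StrongDual.toWeakDual g, (hBm _).2 hg.le, ?_⟩
    change g (b n) = 1
    rw [hgb, h1]; simp
  have hF : supportFace b = ⋂ n, t n := by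
    ext ψ
    simp only [supportFace, Set.mem_ofPred_eq, Set.mem_iInter, t, Set.mem_inter_iff, hBm]
    exact ⟨fun h n => ⟨h.1, h.2 n⟩, fun h => ⟨(h 0).1, fun n => (h n).2⟩⟩
  rw [hF]
  have hsm : ContinuousSMul ℝ (WeakDual ℂ A) := inferInstance
  refine IsCompact.extremePoints_nonempty (E := WeakDual ℂ A) ?_ ?_
  · exact (hB.inter_right (hcl 0)).of_isClosed_subset
      (isClosed_iInter fun n => (hB.inter_right (hcl n)).isClosed) (Set.iInter_subset _ 0)
  · exact IsCompact.nonempty_iInter_of_sequence_nonempty_isCompact_isClosed t hmono hne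
      (hB.inter_right (hcl 0)) fun n => (hB.inter_right (hcl n)).isClosed

end Bump

/-! ### Extremality of a vector state implies irreducibility. -/

section Irreducible

open scoped InnerProductSpace

variable {A : Type*} [CStarAlgebra A]
variable {H : Type*} [NormedAddCommGroup H] [InnerProductSpace ℂ H] [CompleteSpace H]

theorem StarAlgHom.inner_apply_left (π : A →⋆ₐ[ℂ] (H →L[ℂ] H)) (a : A) (x y : H) :
    ⟪π a x, y⟫_ℂ = ⟪x, π (star a) y⟫_ℂ := by
  rw [map_star, ContinuousLinearMap.star_eq_adjoint, ContinuousLinearMap.adjoint_inner_right]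

/-- The functional `a ↦ ⟪x, π a x⟫`. -/
noncomputable def vectorFunctional (π : A →⋆ₐ[ℂ] (H →L[ℂ] H)) (x : H) : A →L[ℂ] ℂ :=
  LinearMap.mkContinuous
    { toFun := fun a => ⟪x, π a x⟫_ℂ
      map_add' := fun a b => by simp
      map_smul' := fun c a => by simp } (‖x‖ * ‖x‖) fun a => by
    refine (norm_inner_le_norm x (π a x)).trans ?_
    rw [mul_assoc]
    refine mul_le_mul_of_nonneg_left (((π a).le_opNorm x).trans ?_) (norm_nonneg _)
    rw [mul_comm]
    exact mul_le_mul_of_nonneg_left (NonUnitalStarAlgHom.norm_apply_le π a) (norm_nonneg _)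

theorem norm_vectorFunctional_le (π : A →⋆ₐ[ℂ] (H →L[ℂ] H)) (x : H) :
    ‖vectorFunctional π x‖ ≤ ‖x‖ * ‖x‖ :=
  LinearMap.mkContinuous_norm_le _ (mul_nonneg (norm_nonneg _) (norm_nonneg _)) _

/-- A cyclic representation whose vector state is not a proper convex combination of other vector
states is irreducible. -/
theorem eq_bot_or_eq_top_of_vectorState_extreme (π : A →⋆ₐ[ℂ] (H →L[ℂ] H)) {ξ : H}
    (hξ : DenseRange fun a => π a ξ) (hn : ‖ξ‖ = 1)
    (hext : ∀ η ζ : H, ‖η‖ = 1 → ‖ζ‖ = 1 → ∀ s t : ℝ, 0 < s → 0 < t → s + t = 1 →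
      (∀ a, ⟪ξ, π a ξ⟫_ℂ = s * ⟪η, π a η⟫_ℂ + t * ⟪ζ, π a ζ⟫_ℂ) →
        ∀ a, ⟪η, π a η⟫_ℂ = ⟪ξ, π a ξ⟫_ℂ)
    (V : Submodule ℂ H) (hV : IsClosed (V : Set H)) (hinv : ∀ a, ∀ x ∈ V, π a x ∈ V) :
    V = ⊥ ∨ V = ⊤ := by
  have : CompleteSpace V := hV.completeSpace_coe
  set η := V.starProjection ξ with hη
  set ζ := ξ - η with hζ
  have hηV : η ∈ V := V.starProjection_apply_mem ξ
  have hζV : ζ ∈ Vᗮ := V.sub_starProjection_mem_orthogonal ξ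
  have hinv' : ∀ a, ∀ x ∈ Vᗮ, π a x ∈ Vᗮ := by
    intro a x hx
    rw [Submodule.mem_orthogonal] at hx ⊢
    intro u hu
    have := StarAlgHom.inner_apply_left π (star a) u x
    rw [star_star] at this
    rw [← this]
    exact hx _ (hinv _ _ hu)
  have hξe : ξ = η + ζ := by simp [hζ]
  have top_of_mem : ∀ W : Submodule ℂ H, IsClosed (W : Set H) → (∀ a, ∀ x ∈ W, π a x ∈ W) →
      ξ ∈ W → W = ⊤ := by
    intro W hW hWi hm
    rw [Submodule.eq_top_iff']
    intro x
    have : closure (Set.range fun a => π a ξ) ⊆ W :=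
      closure_minimal (by rintro _ ⟨a, rfl⟩; exact hWi a ξ hm) hW
    exact this (hξ x)
  by_cases hη0 : η = 0
  · left
    have : Vᗮ = ⊤ := top_of_mem Vᗮ V.isClosed_orthogonal hinv' (by
      rw [hξe, hη0, zero_add]; exact hζV)
    rwa [Submodule.orthogonal_eq_top_iff] at this
  by_cases hζ0 : ζ = 0
  · right
    exact top_of_mem V hV hinv (by rw [hξe, hζ0, add_zero]; exact hηV)
  exfalso
  have hη1 : 0 < ‖η‖ := norm_pos_iff.2 hη0
  have hζ1 : 0 < ‖ζ‖ := norm_pos_iff.2 hζ0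
  have horth : ∀ x ∈ V, ∀ y ∈ Vᗮ, ⟪x, y⟫_ℂ = 0 := fun x hx y hy =>
    (Submodule.mem_orthogonal V y).1 hy x hx
  have horth' : ∀ x ∈ V, ∀ y ∈ Vᗮ, ⟪y, x⟫_ℂ = 0 := fun x hx y hy =>
    inner_eq_zero_symm.1 (horth x hx y hy)
  have hsum : ‖η‖ ^ 2 + ‖ζ‖ ^ 2 = 1 := by
    have := norm_add_sq_eq_norm_sq_add_norm_sq_of_inner_eq_zero η ζ (horth _ hηV _ hζV)
    rw [← hξe, hn] at this
    linarith
  have hscale : ∀ x : H, 0 < ‖x‖ → ∀ a, ((‖x‖ ^ 2 : ℝ) : ℂ) *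
      ⟪((‖x‖⁻¹ : ℝ) : ℂ) • x, π a (((‖x‖⁻¹ : ℝ) : ℂ) • x)⟫_ℂ = ⟪x, π a x⟫_ℂ := by
    intro x hx a
    rw [map_smul, inner_smul_left, inner_smul_right, Complex.conj_ofReal, ← mul_assoc, ← mul_assoc,
      ← Complex.ofReal_mul, ← Complex.ofReal_mul]
    have : ‖x‖ ^ 2 * ‖x‖⁻¹ * ‖x‖⁻¹ = 1 := by field_simp
    rw [this, Complex.ofReal_one, one_mul]
  have hunit : ∀ x : H, 0 < ‖x‖ → ‖((‖x‖⁻¹ : ℝ) : ℂ) • x‖ = 1 := by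
    intro x hx
    rw [norm_smul, Complex.norm_real, norm_inv, norm_norm, inv_mul_cancel₀ hx.ne']
  have hdec : ∀ a, ⟪ξ, π a ξ⟫_ℂ = ⟪η, π a η⟫_ℂ + ⟪ζ, π a ζ⟫_ℂ := by
    intro a
    conv_lhs => rw [hξe]
    rw [map_add, inner_add_left, inner_add_right, inner_add_right,
      horth η hηV _ (hinv' a ζ hζV), horth' _ (hinv a η hηV) ζ hζV]
    ring
  -- The components of `ξ` in `V` and `Vᗮ`, normalised, exhibit its state as a convex combination
  -- with weights `‖η‖²` and `‖ζ‖²`.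
  have key := hext _ _ (hunit η hη1) (hunit ζ hζ1) (‖η‖ ^ 2) (‖ζ‖ ^ 2) (by positivity)
    (by positivity) hsum (fun a => by rw [hscale η hη1, hscale ζ hζ1, hdec])
  -- Equality of the two states says that `η - ‖η‖² ξ` is orthogonal to the orbit of the cyclic
  -- vector, so `ξ` is a multiple of `η` and lies in `V`.
  have key2 : ∀ a, ⟪η - ((‖η‖ ^ 2 : ℝ) : ℂ) • ξ, π a ξ⟫_ℂ = 0 := by
    intro a
    rw [inner_sub_left, inner_smul_left, Complex.conj_ofReal, ← key a, hscale η hη1]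
    conv_lhs => rw [hξe]
    rw [map_add, inner_add_right, horth η hηV _ (hinv' a ζ hζV)]
    ring
  have key3 : η - ((‖η‖ ^ 2 : ℝ) : ℂ) • ξ = 0 := by
    refine hξ.eq_zero_of_inner_left ℂ ?_
    exact fun _ => key2 _
  have hmem : ξ ∈ V := by
    have hne : ((‖η‖ ^ 2 : ℝ) : ℂ) ≠ 0 := by exact_mod_cast (by positivity)
    rw [← V.smul_mem_iff hne, ← sub_eq_zero.1 key3]
    exact hηV
  exact hζ0 (by rw [hζ, hη, Submodule.starProjection_eq_self_iff.2 hmem, sub_self])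

end Irreducible

/-! ### Test elements that detect the norm. -/

section Faithful

open scoped InnerProductSpace

variable {A : Type*} [CStarAlgebra A]
variable {B : Type*} [CStarAlgebra B]

theorem StarAlgHom.continuous_of_cstarAlgebra (π : A →⋆ₐ[ℂ] B) : Continuous π :=
  AddMonoidHomClass.continuous_of_bound π 1 fun x => by
    simpa using NonUnitalStarAlgHom.norm_apply_le π x

/-- The positive part of `a* a - ‖a‖² / 4`. -/
noncomputable def cutoff (a : A) : A :=
  cfc (fun t : ℝ => max (t - ‖a‖ ^ 2 / 4) 0) (star a * a)

theorem cutoff_ne_zero [PartialOrder A] [StarOrderedRing A] [Nontrivial A] {a : A} (ha : a ≠ 0) :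
    cutoff a ≠ 0 := by
  intro h0
  rw [cutoff, ← cfc_zero ℝ (star a * a), cfc_eq_cfc_iff_eqOn (IsSelfAdjoint.star_mul_self a)
    (by fun_prop) continuous_zero.continuousOn] at h0
  have := h0 (CStarAlgebra.norm_mem_spectrum_of_nonneg (star_mul_self_nonneg a))
  have hpos : 0 < ‖a‖ := norm_pos_iff.2 ha
  rw [CStarRing.norm_star_mul_self] at this
  simp only [Pi.zero_apply, max_eq_right_iff] at this
  nlinarith

/-- If `‖π a‖ < ‖a‖ / 2`, the spectrum of `π (a⋆ a)` lies where the cutoff function vanishes. The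
conclusion is a closed condition on `a`, so it need only be tested on a dense sequence. -/
theorem half_norm_le_of_map_cutoff_ne_zero [Nontrivial B] (π : A →⋆ₐ[ℂ] B) {a : A}
    (h : π (cutoff a) ≠ 0) : ‖a‖ / 2 ≤ ‖π a‖ := by
  contrapose! h
  have hsa : IsSelfAdjoint (π (star a * a)) := (IsSelfAdjoint.star_mul_self a).map π
  rw [cutoff, StarAlgHom.map_cfc π _ _ (by fun_prop) 
(StarAlgHom.continuous_of_cstarAlgebra π), ← cfc_zero ℝ (π (star a * a)),
    cfc_eq_cfc_iff_eqOn hsa (by fun_prop) continuous_zero.continuousOn]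
  intro t ht
  have h1 := (le_abs_self t).trans (spectrum.norm_le_norm_of_mem ht)
  rw [map_mul, map_star, CStarRing.norm_star_mul_self] at h1
  simp only [Pi.zero_apply, max_eq_right_iff]
  nlinarith [norm_nonneg (π a)]

end Faithful

/-! ### Faithful irreducible GNS representation. -/

section Gns

open scoped InnerProductSpace


/-- A separable prime C⋆-algebra has a faithful irreducible representation. -/
theorem exists_injective_irreducible_of_prime (A : Type u) [CStarAlgebra A] [Nontrivial A]
    [TopologicalSpace.SeparableSpace A]
    (hA : ∀ a b : A, a ≠ 0 → b ≠ 0 → ∃ x, a * x * b ≠ 0) :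
    ∃ (H : Type u) (_ : NormedAddCommGroup H) (_ : InnerProductSpace ℂ H) (_ : CompleteSpace H)
      (π : A →⋆ₐ[ℂ] (H →L[ℂ] H)), Function.Injective π ∧ Nontrivial H ∧
      ∀ V : Submodule ℂ H, IsClosed (V : Set H) → (∀ a, ∀ x ∈ V, π a x ∈ V) → V = ⊥ ∨ V = ⊤ := by
  let _ : PartialOrder A := CStarAlgebra.spectralOrder A
  have : StarOrderedRing A := CStarAlgebra.spectralOrderedRing A
  let d : ℕ → A := TopologicalSpace.denseSeq A
  have hd : DenseRange d := TopologicalSpace.denseRange_denseSeq A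
  classical
  -- The value `1` only keeps `h n` nonzero; the norm bound is trivial when `d n = 0`.
  let h : ℕ → A := fun n => if d n = 0 then 1 else cutoff (d n)
  have hh : ∀ n, h n ≠ 0 := by
    intro n
    by_cases h0 : d n = 0
    · simp [h, h0]
    · simp only [h, h0, if_false]; exact cutoff_ne_zero h0
  obtain ⟨b, hb0, hb1, hbb, hbh⟩ := exists_bump_seq_of_prime hA h hh
  obtain ⟨φ, hφ⟩ := exists_extremePoint_supportFace hb0 hb1 hbb
  have hφF := hφ.1
  set φ' : A →L[ℂ] ℂ := WeakDual.toStrongDual φ with hφ'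
  have hφn : ‖φ'‖ ≤ 1 := hφF.1
  have hφb : ∀ n, φ' (b n) = 1 := hφF.2
  have hφ1 : φ' 1 = 1 := apply_one_of_apply_eq_one hφn (hb0 0) (hb1 0).le (hφb 0)
  let f : A →ₚ[ℂ] ℂ := PositiveLinearMap.mk₀ φ'.toLinearMap
    fun a ha => apply_nonneg_of_norm_le_one hφn hφ1 ha
  have hf : ∀ a, f a = φ' a := fun a => rfl
  let π := f.gnsStarAlgHom
  let ξ : f.GNS := ((f.toPreGNS 1 : f.PreGNS) : f.GNS)
  have hπξ : ∀ a, π a ξ = ((f.toPreGNS a : f.PreGNS) : f.GNS) := by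
    intro a
    simp [π, ξ]
  have hcoef : ∀ a, ⟪ξ, π a ξ⟫_ℂ = φ' a := by
    intro a
    rw [hπξ]
    simp [ξ, PositiveLinearMap.preGNS_inner_def, hf]
  have hdense : DenseRange fun a => π a ξ := by
    have : (fun a => π a ξ) = (fun x : f.PreGNS => (x : f.GNS)) ∘ f.toPreGNS := funext hπξ
    rw [this]
    exact UniformSpace.Completion.denseRange_coe.comp f.toPreGNS.surjective.denseRange
      (UniformSpace.Completion.continuous_coe _)
  have hξ1 : ‖ξ‖ = 1 := by
    have h1 := hcoef 1
    rw [map_one, one_apply_eq_self, hφ1] at h1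
    have h2 : ‖ξ‖ ^ 2 = 1 := by rw [@norm_sq_eq_re_inner ℂ, h1]; simp
    nlinarith [norm_nonneg ξ]
  have hnt : Nontrivial f.GNS := ⟨ξ, 0, fun h0 => by simp [h0] at hξ1⟩
  -- If `π` killed `h n` it would kill `b n = u * h n * v`, against `φ' (b n) = 1`.
  have hπh : ∀ n, π (h n) ≠ 0 := by
    intro n h0
    obtain ⟨u, v, huv⟩ := hbh n
    have := hcoef (b n)
    rw [huv, map_mul, map_mul, h0, ← huv, hφb] at this
    simp at this
  have hlow : ∀ a, ‖a‖ / 2 ≤ ‖π a‖ := by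
    have hcont : Continuous π := StarAlgHom.continuous_of_cstarAlgebra π
    intro a
    refine hd.induction_on (p := fun a => ‖a‖ / 2 ≤ ‖π a‖) a
      (isClosed_le (by fun_prop) (by fun_prop)) fun n => ?_
    by_cases h0 : d n = 0
    · simp [h0]
    · refine half_norm_le_of_map_cutoff_ne_zero π ?_
      have := hπh n
      simpa only [h, h0, if_false] using this
  refine ⟨f.GNS, inferInstance, inferInstance, inferInstance, π, ?_, hnt, ?_⟩
  · rw [injective_iff_map_eq_zero]
    intro a ha
    have := hlow a
    rw [ha, norm_zero] at this
    exact norm_le_zero_iff.1 (by linarith)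
  · refine eq_bot_or_eq_top_of_vectorState_extreme π hdense hξ1 ?_
    intro η ζ hη hζ s t hs ht hst hdec
    let ω : f.GNS → WeakDual ℂ A := fun x => StrongDual.toWeakDual (vectorFunctional π x)
    have hω : ∀ x a, ω x a = ⟪x, π a x⟫_ℂ := fun x a => rfl
    have hωn : ∀ x : f.GNS, ‖x‖ = 1 → ‖WeakDual.toStrongDual (ω x)‖ ≤ 1 := by
      intro x hx
      exact (norm_vectorFunctional_le π x).trans (by simp [hx])
    have hsplit : ∀ a, φ a = s * ω η a + t * ω ζ a := fun a => by
      rw [hω, hω, ← hdec, hcoef]; rfl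
    have hbd : ∀ x : f.GNS, ‖x‖ = 1 → ∀ n, ‖ω x (b n)‖ ≤ 1 := by
      intro x hx n
      exact ((WeakDual.toStrongDual (ω x)).le_opNorm (b n)).trans
        (mul_le_one₀ (hωn x hx) (norm_nonneg _) (hb1 n).le)
    have eq_one : ∀ z : ℂ, ‖z‖ ≤ 1 → 1 ≤ z.re → z = 1 := by
      intro z hz hre
      have h1 : z.re = 1 := le_antisymm ((Complex.re_le_norm z).trans hz) hre
      have h2 := Complex.sq_norm z
      rw [Complex.normSq_apply, h1] at h2
      exact Complex.ext h1 (by simp; nlinarith [norm_nonneg z])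
    -- A proper convex combination of reals at most `1` equals `1` only if both are `1`. Hence both
    -- vector states lie in `supportFace b`, and the extremality of `φ` within it suffices.
    have hre : ∀ n, s * (ω η (b n)).re + t * (ω ζ (b n)).re = 1 := by
      intro n
      have := congrArg Complex.re (hsplit (b n))
      rw [show φ (b n) = 1 from hφb n] at this
      simpa using this.symm
    have hη1 : ∀ n, (ω η (b n)).re ≤ 1 := fun n => (Complex.re_le_norm _).trans (hbd η hη n)
    have hζ1 : ∀ n, (ω ζ (b n)).re ≤ 1 := fun n => (Complex.re_le_norm _).trans (hbd ζ hζ n)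
    have hηF : ω η ∈ supportFace b :=
      ⟨hωn η hη, fun n => eq_one _ (hbd η hη n) (by nlinarith [hre n, hζ1 n])⟩
    have hζF : ω ζ ∈ supportFace b :=
      ⟨hωn ζ hζ, fun n => eq_one _ (hbd ζ hζ n) (by nlinarith [hre n, hη1 n])⟩
    have hseg : φ ∈ openSegment ℝ (ω η) (ω ζ) := by
      refine ⟨s, t, hs, ht, hst, ?_⟩
      exact DFunLike.ext _ _ fun a => (hsplit a).symm
    have := hφ.2 hηF hζF hseg
    intro a
    rw [← hω, this, hcoef]
    rfl

end Gns

/-! ### Weak containment via positivity in the group ring. -/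

section WeakContainment

open scoped InnerProductSpace

namespace UnitaryRepr

variable {Γ : Type*} [Group Γ]
variable {H : Type*} [NormedAddCommGroup H] [InnerProductSpace ℂ H]
variable {K : Type*} [NormedAddCommGroup K] [InnerProductSpace ℂ K]

/-- The restrictions to `F` of finite sums of diagonal matrix coefficients. -/
def coeffSums (σ : UnitaryRepr Γ K) (F : Finset Γ) : Set (F → ℂ) :=
  {v | ∃ (n : ℕ) (η : Fin n → K), ∀ g : F, v g = ∑ i, diagCoeff σ (η i) g}

theorem zero_mem_coeffSums (σ : UnitaryRepr Γ K) (F : Finset Γ) : 0 ∈ coeffSums σ F :=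
  ⟨0, Fin.elim0, fun g => by simp⟩

theorem add_mem_coeffSums {σ : UnitaryRepr Γ K} {F : Finset Γ} {v w : F → ℂ}
    (hv : v ∈ coeffSums σ F) (hw : w ∈ coeffSums σ F) : v + w ∈ coeffSums σ F := by
  obtain ⟨n, η, hη⟩ := hv
  obtain ⟨m, ζ, hζ⟩ := hw
  refine ⟨n + m, Fin.append η ζ, fun g => ?_⟩
  rw [Fin.sum_univ_add, Pi.add_apply, hη, hζ]
  simp

theorem diagCoeff_sqrt_smul (σ : UnitaryRepr Γ K) {r : ℝ} (hr : 0 ≤ r) (η : K) (g : Γ) :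
    diagCoeff σ (((√r : ℝ) : ℂ) • η) g = r * diagCoeff σ η g := by
  rw [diagCoeff, map_smul, inner_smul_left, inner_smul_right, Complex.conj_ofReal, ← mul_assoc,
    ← Complex.ofReal_mul, Real.mul_self_sqrt hr, diagCoeff]

theorem smul_mem_coeffSums {σ : UnitaryRepr Γ K} {F : Finset Γ} {v : F → ℂ} {r : ℝ} (hr : 0 ≤ r)
    (hv : v ∈ coeffSums σ F) : r • v ∈ coeffSums σ F := by
  obtain ⟨n, η, hη⟩ := hv
  refine ⟨n, fun i => ((√r : ℝ) : ℂ) • η i, fun g => ?_⟩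
  simp only [diagCoeff_sqrt_smul σ hr, Pi.smul_apply, hη, Complex.real_smul, Finset.mul_sum]

theorem diagCoeff_mem_coeffSums (σ : UnitaryRepr Γ K) (F : Finset Γ) (η : K) :
    (fun g : F => diagCoeff σ η g) ∈ coeffSums σ F :=
  ⟨1, fun _ => η, fun g => by simp⟩

theorem convex_coeffSums (σ : UnitaryRepr Γ K) (F : Finset Γ) : Convex ℝ (coeffSums σ F) :=
  fun _ hv _ hw _ _ ha hb _ => add_mem_coeffSums (smul_mem_coeffSums ha hv)
    (smul_mem_coeffSums hb hw)

/-- Weak containment follows from the inclusion of the sets of group ring elements that are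
nonpositive in the representations. -/
theorem weaklyContained_of_nonpos {ρ : UnitaryRepr Γ H} {σ : UnitaryRepr Γ K}
    (h : ∀ (F : Finset Γ) (c : F → ℂ), (∀ η, (∑ g : F, c g * diagCoeff σ η g).re ≤ 0) →
      ∀ ξ, (∑ g : F, c g * diagCoeff ρ ξ g).re ≤ 0) : WeaklyContained ρ σ := by
  classical
  intro ξ F ε hε
  set p : F → ℂ := fun g => diagCoeff ρ ξ g with hp
  by_cases hmem : p ∈ closure (coeffSums σ F)
  · obtain ⟨v, ⟨n, η, hv⟩, hd⟩ := Metric.mem_closure_iff.1 hmem ε hε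
    refine ⟨n, η, fun g hg => ?_⟩
    rw [← hv ⟨g, hg⟩, ← dist_eq_norm]
    exact (dist_le_pi_dist p v ⟨g, hg⟩).trans_lt hd
  · exfalso
    obtain ⟨f, u, hfu, hup⟩ := RCLike.geometric_hahn_banach_closed_point (𝕜 := ℂ)
      (convex_coeffSums σ F).closure isClosed_closure hmem
    have hf : ∀ v : F → ℂ, f v = ∑ g : F, f (Pi.single g 1) * v g := by
      intro v
      conv_lhs => rw [pi_eq_sum_univ' v]
      rw [map_sum]
      refine Finset.sum_congr rfl fun g _ => ?_
      rw [map_smul, smul_eq_mul, mul_comm]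
    have hu : 0 < u := by
      simpa using hfu 0 (subset_closure (zero_mem_coeffSums σ F))
    have hle : ∀ v ∈ coeffSums σ F, (f v).re ≤ 0 := by
      intro v hv
      by_contra! hpos
      -- The sums form a cone: this rescaling would bring the separating functional to exactly `u`,
      -- contradicting the strict inequality. So it is nonpositive on the whole cone.
      have := hfu _ (subset_closure (smul_mem_coeffSums (r := u / (f v).re) (by positivity) hv))
      rw [← Complex.coe_smul, map_smul, smul_eq_mul] at this
      simp only [RCLike.re_to_complex, Complex.re_ofReal_mul, div_mul_cancel₀ _ hpos.ne'] at this
      exact lt_irrefl _ this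
    have := h F (fun g => f (Pi.single g 1)) (fun η => by
      rw [← hf (fun g : F => diagCoeff σ η g)]
      exact hle _ (diagCoeff_mem_coeffSums σ F η)) ξ
    rw [← hf p] at this
    exact absurd (hu.trans hup) (not_lt.2 this)

end UnitaryRepr

variable {A : Type*} [CStarAlgebra A]
variable {H : Type*} [NormedAddCommGroup H] [InnerProductSpace ℂ H] [CompleteSpace H]
variable {K : Type*} [NormedAddCommGroup K] [InnerProductSpace ℂ K] [CompleteSpace K]

/-- A self-adjoint element with positive image in a faithful representation has positive image in
every representation. -/
theorem map_nonneg_of_injective (ι : A →⋆ₐ[ℂ] (H →L[ℂ] H)) {π : A →⋆ₐ[ℂ] (K →L[ℂ] K)}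
    (hπ : Function.Injective π) {a : A} (ha : IsSelfAdjoint a) (h : 0 ≤ π a) : 0 ≤ ι a := by
  rw [StarOrderedRing.nonneg_iff_spectrum_nonneg (R := ℝ) (ι a) (ha.map ι)]
  intro t ht
  -- The spectrum can only shrink under `ι`, while the injective `π` preserves it.
  have h1 : t ∈ spectrum ℝ a :=
    AlgHom.spectrum_apply_subset ((ι : A →⋆ₐ[ℂ] (H →L[ℂ] H)).restrictScalars ℝ) a ht
  rw [← ha.map_spectrum_real π hπ] at h1
  exact spectrum_nonneg_of_nonneg h h1

theorem UnitaryRepr.inner_map_neg_add_star {Γ : Type*} [Group Γ] {u : Γ → A}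
    {π : A →⋆ₐ[ℂ] (H →L[ℂ] H)} {ρ : UnitaryRepr Γ H} (hρ : ∀ g x, ρ g x = π (u g) x)
    {F : Finset Γ} (c : F → ℂ) (x : H) :
    ⟪x, π (-((∑ g : F, c g • u g) + star (∑ g : F, c g • u g))) x⟫_ℂ =
      ((-2 * (∑ g : F, c g * diagCoeff ρ x g).re : ℝ) : ℂ) := by
  set a : A := ∑ g : F, c g • u g with ha
  have h1 : ⟪x, π a x⟫_ℂ = ∑ g : F, c g * diagCoeff ρ x g := by
    simp [ha, map_sum, diagCoeff, hρ]
  have h2 : ⟪x, π (star a) x⟫_ℂ = (starRingEnd ℂ) ⟪x, π a x⟫_ℂ := by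
    rw [← StarAlgHom.inner_apply_left, inner_conj_symm]
  rw [map_neg, map_add, neg_apply, add_apply, inner_neg_right, inner_add_right, h2, h1,
    Complex.add_conj]
  push_cast
  ring

/-- For `a = ∑ c g • u g`, nonpositivity of all coefficient combinations in `σ` means `π (-(a + star
a)) ≥ 0`; faithfulness of `π` transfers this to `ι`, where it reads as the same condition for `ρ`.
-/
theorem UnitaryRepr.weaklyContained_of_injective {Γ : Type*} [Group Γ] (u : Γ → A)
    (ι : A →⋆ₐ[ℂ] (H →L[ℂ] H)) {π : A →⋆ₐ[ℂ] (K →L[ℂ] K)} (hπ : Function.Injective π)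
    {ρ : UnitaryRepr Γ H} {σ : UnitaryRepr Γ K} (hρ : ∀ g x, ρ g x = ι (u g) x)
    (hσ : ∀ g x, σ g x = π (u g) x) : WeaklyContained ρ σ := by
  refine weaklyContained_of_nonpos fun F c hc ξ => ?_
  set a : A := ∑ g : F, c g • u g with ha
  have hsa : IsSelfAdjoint (-(a + star a)) := (IsSelfAdjoint.add_star_self a).neg
  have hpos : 0 ≤ π (-(a + star a)) := by
    rw [ContinuousLinearMap.nonneg_iff_isPositive, ContinuousLinearMap.isPositive_iff_complex]
    intro η
    rw [← inner_conj_symm, inner_map_neg_add_star hσ c η, Complex.conj_ofReal]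
    refine ⟨by simp, ?_⟩
    have := hc η
    simp only [RCLike.re_to_complex, Complex.ofReal_re]
    linarith
  have h0 := map_nonneg_of_injective ι hπ hsa hpos
  rw [ContinuousLinearMap.nonneg_iff_isPositive] at h0
  have h1 := h0.re_inner_nonneg_right ξ
  rw [inner_map_neg_add_star hρ c ξ] at h1
  simp only [RCLike.re_to_complex, Complex.ofReal_re] at h1
  linarith

end WeakContainment

/-! ### Reducibility from an indefinite intertwiner. -/

section Reducible

open scoped InnerProductSpace

variable {Γ : Type*} [Group Γ]
variable {H : Type*} [NormedAddCommGroup H] [InnerProductSpace ℂ H] [CompleteSpace H]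

/-- A self-adjoint operator that is neither positive nor negative and commutes with a representation
makes it reducible. -/
theorem UnitaryRepr.isReducible_of_commute {ρ : UnitaryRepr Γ H} {T : H →L[ℂ] H}
    (hT : IsSelfAdjoint T) (hρ : ∀ g x, T (ρ g x) = ρ g (T x))
    {x : H} (hx : (⟪x, T x⟫_ℂ).re < 0) {y : H} (hy : 0 < (⟪y, T y⟫_ℂ).re) : ρ.IsReducible := by
  -- `T⁺` inherits commutation with `ρ` from `T` by functional calculus. Its kernel contains the
  -- range of `T⁻`, so a zero kernel would make `T` positive, and a full kernel would make `T`
  -- negative.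
  refine ⟨LinearMap.ker (T⁺ : H →L[ℂ] H).toLinearMap, (T⁺).isClosed_ker, ?_, ?_, ?_⟩
  · intro g ξ hξ
    have hcomm : Commute T (ρ g : H →L[ℂ] H) := ContinuousLinearMap.ext fun z => hρ g z
    have hc : Commute T⁺ (ρ g : H →L[ℂ] H) := by
      rw [CFC.posPart_def]
      exact hcomm.cfcₙ_real _
    have := congrArg (fun S : H →L[ℂ] H => S ξ) hc.eq
    have h0 : T⁺ ξ = 0 := hξ
    change T⁺ (ρ g ξ) = ρ g (T⁺ ξ) at this
    rw [h0, map_zero] at this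
    exact this
  · intro hbot
    have hneg : T⁻ = 0 := by
      refine ContinuousLinearMap.ext fun ξ => ?_
      have : T⁻ ξ ∈ LinearMap.ker (T⁺ : H →L[ℂ] H).toLinearMap :=
        congrArg (fun S : H →L[ℂ] H => S ξ) (CFC.posPart_mul_negPart T)
      rw [hbot] at this
      simpa using this
    have hpos : 0 ≤ T := by
      rw [← CFC.posPart_sub_negPart T hT, hneg, sub_zero]
      exact CFC.posPart_nonneg T
    rw [ContinuousLinearMap.nonneg_iff_isPositive] at hpos
    exact absurd (hpos.re_inner_nonneg_right x) (not_le.2 hx)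
  · intro htop
    have hz : T⁺ = 0 := by
      refine ContinuousLinearMap.ext fun ξ => ?_
      have : ξ ∈ LinearMap.ker (T⁺ : H →L[ℂ] H).toLinearMap := htop ▸ trivial
      exact this
    have hneg : 0 ≤ -T := by
      rw [← CFC.posPart_sub_negPart T hT, hz, zero_sub, neg_neg]
      exact CFC.negPart_nonneg T
    rw [ContinuousLinearMap.nonneg_iff_isPositive] at hneg
    have := hneg.re_inner_nonneg_right y
    rw [neg_apply, inner_neg_right, map_neg] at this
    simp only [RCLike.re_to_complex] at this
    linarith

end Reducible

/-! ### Point masses in `ℓ²(Γ)`. -/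

section PointMass

open scoped InnerProductSpace

variable {Γ : Type*}

open Classical in
/-- The point mass at `x`. -/
noncomputable def pointMass (x : Γ) : EllTwo Γ := lp.single 2 x (1 : ℂ)

open Classical in
theorem pointMass_apply (x y : Γ) : pointMass x y = if y = x then 1 else 0 := by
  rw [pointMass, lp.coeFn_single, Pi.single_apply]

theorem inner_pointMass (x : Γ) (ξ : EllTwo Γ) : ⟪pointMass x, ξ⟫_ℂ = ξ x := by
  classical
  rw [lp.inner_eq_tsum, tsum_eq_single x]
  · simp [pointMass_apply]
  · intro y hy
    simp [pointMass_apply, hy]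

theorem eq_top_of_pointMass_mem {V : Submodule ℂ (EllTwo Γ)} (hV : IsClosed (V : Set (EllTwo Γ)))
    (h : ∀ x, pointMass x ∈ V) : V = ⊤ := by
  classical
  rw [Submodule.eq_top_iff']
  intro ξ
  refine hV.mem_of_tendsto (lp.hasSum_single ENNReal.ofNat_ne_top ξ)
    (Filter.Eventually.of_forall fun s => V.sum_mem fun x _ => ?_)
  have : lp.single (E := fun _ : Γ => ℂ) 2 x (ξ x) = ξ x • pointMass x := by
    ext y
    simp [pointMass, lp.coeFn_single, Pi.single_apply]
  rw [this]
  exact V.smul_mem _ (h x)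

end PointMass

/-! ### Two-sided translations, the icc condition and reducibility of the regular representation. -/

section EllTwoLemmas

open scoped InnerProductSpace

variable {Γ : Type*} [Group Γ]

/-- Right translation `ξ ↦ (x ↦ ξ (x g))` on `ℓ²(Γ)`. -/
noncomputable def rightTranslate (g : Γ) (ξ : EllTwo Γ) : EllTwo Γ :=
  ⟨fun x => ξ (x * g), memℓp_gen
    (((memℓp_gen_iff (by norm_num)).1 (lp.memℓp ξ)).comp_injective (mul_left_injective g))⟩

theorem rightTranslate_apply (g : Γ) (ξ : EllTwo Γ) (x : Γ) :
    rightTranslate g ξ x = ξ (x * g) := rfl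

theorem norm_rightTranslate (g : Γ) (ξ : EllTwo Γ) : ‖rightTranslate g ξ‖ = ‖ξ‖ := by
  rw [lp.norm_eq_tsum_rpow (by norm_num), lp.norm_eq_tsum_rpow (by norm_num)]
  congr 1
  exact (Equiv.mulRight g).tsum_eq (fun x => ‖ξ x‖ ^ (2 : ℝ≥0∞).toReal)

/-- The right regular representation `(ρ_Γ(g) ξ)(x) = ξ(x g)`. -/
noncomputable def rightRegularRepr (Γ : Type*) [Group Γ] : UnitaryRepr Γ (EllTwo Γ) where
  toFun g :=
    { toFun := rightTranslate g
      invFun := rightTranslate g⁻¹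
      left_inv := fun ξ => by ext x; simp [rightTranslate_apply]
      right_inv := fun ξ => by ext x; simp [rightTranslate_apply]
      map_add' := fun _ _ => rfl
      map_smul' := fun _ _ => rfl
      norm_map' := norm_rightTranslate g }
  map_one' := LinearIsometryEquiv.ext fun ξ => by
    ext x; exact congrArg ξ (mul_one x)
  map_mul' g h := LinearIsometryEquiv.ext fun ξ => by
    ext x; exact congrArg ξ (mul_assoc x g h).symm

theorem rightRegularRepr_apply (g : Γ) (ξ : EllTwo Γ) (x : Γ) :
    rightRegularRepr Γ g ξ x = ξ (x * g) := rfl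

theorem leftRegularRepr_rightRegularRepr_comm (g h : Γ) (ξ : EllTwo Γ) :
    leftRegularRepr Γ g (rightRegularRepr Γ h ξ) = rightRegularRepr Γ h (leftRegularRepr Γ g ξ) := by
  ext x
  simp [leftRegularRepr_apply, rightRegularRepr_apply, mul_assoc]

theorem leftRegularRepr_pointMass (g x : Γ) :
    leftRegularRepr Γ g (pointMass x) = pointMass (g * x) := by
  ext y
  rw [leftRegularRepr_apply, pointMass_apply, pointMass_apply]
  classical exact if_congr inv_mul_eq_iff_eq_mul rfl rfl

theorem rightRegularRepr_pointMass (g x : Γ) :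
    rightRegularRepr Γ g (pointMass x) = pointMass (x * g⁻¹) := by
  ext y
  rw [rightRegularRepr_apply, pointMass_apply, pointMass_apply]
  classical exact if_congr eq_mul_inv_iff_mul_eq.symm rfl rfl

/-- A square-summable function that is invariant under conjugation vanishes on infinite conjugacy
classes. -/
theorem apply_eq_zero_of_conj_invariant {ξ : EllTwo Γ} (hξ : ∀ g x, ξ (g * x * g⁻¹) = ξ x) {x : Γ}
    (hx : (conjugatesOf x).Infinite) : ξ x = 0 := by
  have hs := (memℓp_gen_iff (by norm_num)).1 (lp.memℓp ξ)
  by_contra h0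
  have hpos : 0 < ‖ξ x‖ ^ (2 : ℝ≥0∞).toReal := Real.rpow_pos_of_pos (norm_pos_iff.2 h0) _
  -- Summability leaves only finitely many points where `|ξ|²` reaches its value at `x`, yet the
  -- whole conjugacy class consists of such points.
  have hfin := (hs.tendsto_cofinite_zero.eventually (gt_mem_nhds hpos))
  rw [Filter.eventually_cofinite] at hfin
  refine hx (hfin.subset ?_)
  intro y hy
  obtain ⟨c, hc⟩ := isConj_iff.1 (show IsConj x y from hy)
  simp [← hc, hξ]

/-- For an icc group there are no proper closed subspaces of `ℓ²(Γ)` invariant under translations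
on both sides. -/
theorem IsICC.eq_bot_or_eq_top (hΓ : IsICC Γ) {V : Submodule ℂ (EllTwo Γ)}
    (hV : IsClosed (V : Set (EllTwo Γ))) (hl : (leftRegularRepr Γ).IsInvariant V)
    (hr : (rightRegularRepr Γ).IsInvariant V) : V = ⊥ ∨ V = ⊤ := by
  have : CompleteSpace V := hV.completeSpace_coe
  set v := V.starProjection (pointMass 1) with hv
  have hvV : v ∈ V := V.starProjection_apply_mem _
  -- Conjugation fixes the point mass at `1` and preserves `V`, so it fixes the projection `v`; the
  -- icc condition then confines `v` to the identity.
  let U : Γ → EllTwo Γ ≃ₗᵢ[ℂ] EllTwo Γ := fun g => leftRegularRepr Γ g * rightRegularRepr Γ g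
  have hU : ∀ g ξ, U g ξ = leftRegularRepr Γ g (rightRegularRepr Γ g ξ) := fun _ _ => rfl
  have hUV : ∀ g, ∀ ξ ∈ V, U g ξ ∈ V := fun g ξ h => hl g _ (hr g _ h)
  have hUinv : ∀ g ξ, U g (U g⁻¹ ξ) = ξ := by
    intro g ξ
    ext x
    simp only [hU, leftRegularRepr_apply, rightRegularRepr_apply]
    group
  have hU1 : ∀ g, U g (pointMass 1) = pointMass 1 := by
    intro g
    rw [hU, rightRegularRepr_pointMass, leftRegularRepr_pointMass, one_mul, mul_inv_cancel]
  have hinvar : ∀ g, U g v = v := by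
    intro g
    refine (Submodule.eq_starProjection_of_mem_of_inner_eq_zero (hUV g v hvV) ?_).symm
    intro w hw
    have := V.starProjection_inner_eq_zero (pointMass 1) _ (hUV g⁻¹ w hw)
    rw [← hU1 g, ← map_sub, ← hUinv g w, LinearIsometryEquiv.inner_map_map]
    exact this
  have hconj : ∀ g x, v (g * x * g⁻¹) = v x := by
    intro g x
    conv_lhs => rw [← hinvar g]
    rw [hU, leftRegularRepr_apply, rightRegularRepr_apply]
    group
  have hvx : ∀ x, x ≠ 1 → v x = 0 := fun x hx => apply_eq_zero_of_conj_invariant hconj (hΓ.2 x hx)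
  have hveq : v = v 1 • pointMass 1 := by
    ext x
    by_cases hx : x = 1
    · simp [hx, pointMass_apply]
    · simp [hvx x hx, pointMass_apply, hx]
  -- Either the point mass at `1` is orthogonal to `V`, and left invariance makes every coordinate
  -- vanish on `V`, or it lies in `V` together with all its translates.
  by_cases h0 : v 1 = 0
  · left
    rw [h0, zero_smul] at hveq
    have horth : pointMass 1 ∈ Vᗮ := (Submodule.starProjection_apply_eq_zero_iff V).1 hveq
    rw [Submodule.eq_bot_iff]
    intro ξ hξ
    ext x
    have := (Submodule.mem_orthogonal V _).1 horth _ (hl x⁻¹ ξ hξ)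
    rw [← inner_conj_symm, inner_pointMass, leftRegularRepr_apply] at this
    simpa using this
  · right
    refine eq_top_of_pointMass_mem hV fun x => ?_
    have h1 : pointMass (1 : Γ) ∈ V := by
      rw [← V.smul_mem_iff h0, ← hveq]
      exact hvV
    simpa [leftRegularRepr_pointMass] using hl x _ h1

/-- The regular representation of a nontrivial group is reducible. -/
theorem isReducible_leftRegularRepr [Nontrivial Γ] : (leftRegularRepr Γ).IsReducible := by
  obtain ⟨g, hg⟩ := exists_ne (1 : Γ)
  let R : Γ → EllTwo Γ →L[ℂ] EllTwo Γ := fun g => (rightRegularRepr Γ g : EllTwo Γ →L[ℂ] EllTwo Γ)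
  let T := R g + R g⁻¹
  have hT : ∀ ξ x, T ξ x = ξ (x * g) + ξ (x * g⁻¹) := fun _ _ => rfl
  have hadj : ∀ ξ η : EllTwo Γ, ∀ h, ⟪R h ξ, η⟫_ℂ = ⟪ξ, R h⁻¹ η⟫_ℂ := by
    intro ξ η h
    have : η = R h (R h⁻¹ η) := by
      ext x
      change η x = η (x * h * h⁻¹)
      simp
    conv_lhs => rw [this]
    exact LinearIsometryEquiv.inner_map_map (rightRegularRepr Γ h) _ _
  have hsa : IsSelfAdjoint T := by
    rw [ContinuousLinearMap.isSelfAdjoint_iff_isSymmetric]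
    intro ξ η
    change ⟪R g ξ + R g⁻¹ ξ, η⟫_ℂ = ⟪ξ, R g η + R g⁻¹ η⟫_ℂ
    rw [inner_add_left, inner_add_right, hadj, hadj, inv_inv, add_comm]
  have hg' : g⁻¹ ≠ 1 := inv_ne_one.2 hg
  -- The sign is that of `Re c`, so `c = -1` and `c = 1` show that `T` is indefinite. The term
  -- `pointMass g g⁻¹` accounts for the case `g² = 1`.
  have hval : ∀ c : ℂ, ⟪pointMass 1 + c • pointMass g, T (pointMass 1 + c • pointMass g)⟫_ℂ =
      (c + (starRingEnd ℂ) c) * (1 + pointMass g g⁻¹) := by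
    intro c
    have hgg : pointMass (1 : Γ) (g * g) = pointMass g g⁻¹ := by
      rw [pointMass_apply, pointMass_apply]
      classical exact if_congr (mul_eq_one_iff_eq_inv.trans eq_comm) rfl rfl
    rw [inner_add_left, inner_smul_left, inner_pointMass, inner_pointMass, hT, hT]
    simp only [lp.coeFn_add, lp.coeFn_smul, Pi.add_apply, Pi.smul_apply, hgg, smul_eq_mul]
    simp [pointMass_apply, hg, hg', hg.symm]
    split_ifs <;> ring
  have hnorm : 0 < (1 + pointMass g g⁻¹ : ℂ).re := by
    rw [pointMass_apply]
    split_ifs <;> norm_num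
  refine UnitaryRepr.isReducible_of_commute hsa (fun h ξ => ?_)
    (x := pointMass 1 + (-1 : ℂ) • pointMass g) ?_ (y := pointMass 1 + (1 : ℂ) • pointMass g) ?_
  · ext x
    rw [hT, leftRegularRepr_apply, leftRegularRepr_apply, leftRegularRepr_apply, hT, mul_assoc,
      mul_assoc]
  · rw [hval]
    simp only [map_neg, map_one, Complex.mul_re, Complex.add_re, Complex.neg_re, Complex.one_re,
      Complex.add_im, Complex.neg_im, Complex.one_im] at hnorm ⊢
    linarith
  · rw [hval]
    simp only [map_one, Complex.mul_re, Complex.add_re, Complex.one_re,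
      Complex.add_im, Complex.one_im] at hnorm ⊢
    linarith

end EllTwoLemmas

/-! ### The C⋆-algebra generated by a unitary representation. -/

section ReducedAlgebra

open scoped InnerProductSpace

namespace UnitaryRepr

variable {Γ : Type*} [Group Γ]
variable {H : Type*} [NormedAddCommGroup H] [InnerProductSpace ℂ H] [CompleteSpace H]

/-- The operators of a unitary representation, as unitary elements of the algebra of bounded
operators. -/
noncomputable def toUnitary (ρ : UnitaryRepr Γ H) : Γ →* unitary (H →L[ℂ] H) :=
  (Unitary.linearIsometryEquiv (𝕜 := ℂ) (H := H)).symm.toMonoidHom.comp ρ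

/-- The ⋆-algebra of finite linear combinations of the operators of a representation. -/
noncomputable def spanAlgebra (ρ : UnitaryRepr Γ H) : StarSubalgebra ℂ (H →L[ℂ] H) where
  __ := Algebra.adjoin ℂ (Set.range fun g => (ρ.toUnitary g : H →L[ℂ] H))
  star_mem' := by
    intro a ha
    induction ha using Algebra.adjoin_induction with
    | mem x hx =>
      obtain ⟨g, rfl⟩ := hx
      exact Algebra.subset_adjoin ⟨g⁻¹, congrArg Subtype.val (map_inv ρ.toUnitary g)⟩
    | algebraMap r => rw [← algebraMap_star_comm]; exact Subalgebra.algebraMap_mem _ _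
    | add x y _ _ hx hy => rw [star_add]; exact Subalgebra.add_mem _ hx hy
    | mul x y _ _ hx hy => rw [star_mul]; exact Subalgebra.mul_mem _ hy hx

/-- The C⋆-algebra generated by a unitary representation. -/
noncomputable def cstarAlgebra (ρ : UnitaryRepr Γ H) : StarSubalgebra ℂ (H →L[ℂ] H) :=
  ρ.spanAlgebra.topologicalClosure

theorem isClosed_cstarAlgebra (ρ : UnitaryRepr Γ H) :
    IsClosed (ρ.cstarAlgebra : Set (H →L[ℂ] H)) :=
  ρ.spanAlgebra.isClosed_topologicalClosure

theorem coe_cstarAlgebra (ρ : UnitaryRepr Γ H) : (ρ.cstarAlgebra : Set (H →L[ℂ] H)) =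
    closure (Submodule.span ℂ (Set.range fun g => (ρ.toUnitary g : H →L[ℂ] H))) := by
  have h : (ρ.spanAlgebra : Set (H →L[ℂ] H)) =
      Submodule.span ℂ (Set.range fun g => (ρ.toUnitary g : H →L[ℂ] H)) := by
    have h1 := Algebra.adjoin_eq_span (R := ℂ) (Set.range fun g => (ρ.toUnitary g : H →L[ℂ] H))
    -- The operators of the group are already closed under products, so the algebra they generate is
    -- their linear span.
    have h2 : Submonoid.closure (Set.range fun g => (ρ.toUnitary g : H →L[ℂ] H)) =
        MonoidHom.mrange ((unitary (H →L[ℂ] H)).subtype.comp ρ.toUnitary) :=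
      Submonoid.closure_eq (MonoidHom.mrange ((unitary (H →L[ℂ] H)).subtype.comp ρ.toUnitary))
    rw [h2] at h1
    exact congrArg (fun S : Submodule ℂ (H →L[ℂ] H) => (S : Set (H →L[ℂ] H))) h1
  rw [← h]
  rfl

theorem toUnitary_mem_cstarAlgebra (ρ : UnitaryRepr Γ H) (g : Γ) :
    (ρ.toUnitary g : H →L[ℂ] H) ∈ ρ.cstarAlgebra := by
  rw [← SetLike.mem_coe, coe_cstarAlgebra]
  exact subset_closure (Submodule.subset_span ⟨g, rfl⟩)

/-- A closed subspace of operators that contains the group contains the generated C⋆-algebra. -/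
theorem mem_of_mem_cstarAlgebra {ρ : UnitaryRepr Γ H} {S : Submodule ℂ (H →L[ℂ] H)}
    (hS : IsClosed (S : Set (H →L[ℂ] H))) (h : ∀ g, (ρ.toUnitary g : H →L[ℂ] H) ∈ S)
    {a : H →L[ℂ] H} (ha : a ∈ ρ.cstarAlgebra) : a ∈ S := by
  rw [← SetLike.mem_coe, coe_cstarAlgebra] at ha
  exact closure_minimal (Submodule.span_le.2 (by rintro _ ⟨g, rfl⟩; exact h g)) hS ha

theorem isSeparable_cstarAlgebra [Countable Γ] (ρ : UnitaryRepr Γ H) :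
    TopologicalSpace.IsSeparable (ρ.cstarAlgebra : Set (H →L[ℂ] H)) := by
  rw [coe_cstarAlgebra]
  exact (Set.countable_range _).isSeparable.span.closure

/-- A unitary representation of a countable group that generates a prime C⋆-algebra is weakly
equivalent to an irreducible one. -/
theorem exists_irreducible_weaklyEquivalent {Γ : Type*} [Group Γ] [Countable Γ] {H : Type u}
    [NormedAddCommGroup H] [InnerProductSpace ℂ H] [CompleteSpace H] [Nontrivial H]
    (ρ : UnitaryRepr Γ H)
    (hρ : ∀ a ∈ ρ.cstarAlgebra, ∀ b ∈ ρ.cstarAlgebra, a ≠ 0 → b ≠ 0 →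
      ∃ g x, a (ρ g (b x)) ≠ 0) :
    ∃ (K : Type u) (_ : NormedAddCommGroup K) (_ : InnerProductSpace ℂ K) (_ : CompleteSpace K)
      (π : UnitaryRepr Γ K), IsIrreducible π ∧ WeaklyEquivalent ρ π := by
  have : IsClosed (ρ.cstarAlgebra : Set (H →L[ℂ] H)) := ρ.isClosed_cstarAlgebra
  let A := ρ.cstarAlgebra
  have : TopologicalSpace.SeparableSpace A := ρ.isSeparable_cstarAlgebra.separableSpace
  let u : Γ → A := fun g => ⟨ρ.toUnitary g, ρ.toUnitary_mem_cstarAlgebra g⟩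
  have hu1 : u 1 = 1 := Subtype.ext
    (congrArg (fun w : unitary (H →L[ℂ] H) => (w : H →L[ℂ] H)) (map_one ρ.toUnitary))
  have hu2 : ∀ g h, u (g * h) = u g * u h := fun g h => Subtype.ext
    (congrArg (fun w : unitary (H →L[ℂ] H) => (w : H →L[ℂ] H)) (map_mul ρ.toUnitary g h))
  let v : Γ →* unitary A :=
    { toFun := fun g => ⟨u g, by
        rw [Unitary.mem_iff]
        exact ⟨Subtype.ext (Unitary.coe_star_mul_self (ρ.toUnitary g)),
          Subtype.ext (Unitary.coe_mul_star_self (ρ.toUnitary g))⟩⟩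
      map_one' := Subtype.ext hu1
      map_mul' := fun g h => Subtype.ext (hu2 g h) }
  obtain ⟨K, i1, i2, i3, π, hπ, hnt, hirr⟩ :=
    exists_injective_irreducible_of_prime A (by
      intro a b ha hb
      obtain ⟨g, x, hgx⟩ := hρ a a.2 b b.2 (fun h => ha (Subtype.ext h))
        (fun h => hb (Subtype.ext h))
      refine ⟨u g, fun h => hgx ?_⟩
      have := congrArg (fun c : A => (c : H →L[ℂ] H) x) h
      exact this)
  let σ : UnitaryRepr Γ K :=
    (Unitary.linearIsometryEquiv (𝕜 := ℂ) (H := K)).toMonoidHom.comp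
      ((Unitary.map (.ofClass π : A →⋆* (K →L[ℂ] K))).toMonoidHom.comp v)
  have hσ : ∀ g x, σ g x = π (u g) x := fun g x => rfl
  have hρ' : ∀ g x, ρ g x = A.subtype (u g) x := fun g x => rfl
  refine ⟨K, i1, i2, i3, σ, ⟨hnt, fun V hV hinv => hirr V hV fun a ξ hξ => ?_⟩,
    weaklyContained_of_injective u A.subtype hπ hρ' hσ,
    weaklyContained_of_injective u π Subtype.val_injective hσ hρ'⟩
  have hπc : Continuous π := StarAlgHom.continuous_of_cstarAlgebra π
  -- Density of the span of the group in `A` upgrades invariance of the closed subspace `V` from `σ`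
  -- to `π`.
  have hdense : Dense ((Submodule.span ℂ (Set.range u) : Submodule ℂ A) : Set A) := by
    intro a
    rw [Topology.IsInducing.subtypeVal.closure_eq_preimage_closure_image]
    have himg : Subtype.val '' ((Submodule.span ℂ (Set.range u) : Submodule ℂ A) : Set A) =
        (Submodule.span ℂ (Set.range fun g => (ρ.toUnitary g : H →L[ℂ] H)) :
          Set (H →L[ℂ] H)) := by
      have := Submodule.map_span A.subtype.toLinearMap (Set.range u)
      rw [← Set.range_comp] at this
      exact congrArg (fun S : Submodule ℂ (H →L[ℂ] H) => (S : Set (H →L[ℂ] H))) this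
    have hmem : (a : H →L[ℂ] H) ∈ (ρ.cstarAlgebra : Set (H →L[ℂ] H)) := a.2
    rw [coe_cstarAlgebra] at hmem
    exact closure_mono himg.ge hmem
  let S : Submodule ℂ A :=
    V.comap ((ContinuousLinearMap.apply ℂ K ξ).toLinearMap ∘ₗ π.toLinearMap)
  have hS : IsClosed (S : Set A) :=
    hV.preimage ((ContinuousLinearMap.apply ℂ K ξ).continuous.comp hπc)
  have hle : Submodule.span ℂ (Set.range u) ≤ S :=
    Submodule.span_le.2 (by rintro _ ⟨g, rfl⟩; exact hinv g ξ hξ)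
  exact closure_minimal hle hS (hdense a)

end UnitaryRepr

end ReducedAlgebra

/-! ### Primeness of the reduced C⋆-algebra of an icc group. -/

section Regular

variable {Γ : Type*} [Group Γ]

/-- Commuting with a fixed right translation is a closed linear condition, satisfied by left
translations. -/
theorem rightRegularRepr_apply_of_mem_cstarAlgebra {a : EllTwo Γ →L[ℂ] EllTwo Γ}
    (ha : a ∈ (leftRegularRepr Γ).cstarAlgebra) (h : Γ) (ξ : EllTwo Γ) :
    a (rightRegularRepr Γ h ξ) = rightRegularRepr Γ h (a ξ) := by
  let R : EllTwo Γ →L[ℂ] EllTwo Γ := (rightRegularRepr Γ h : EllTwo Γ →L[ℂ] EllTwo Γ)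
  let S : Submodule ℂ (EllTwo Γ →L[ℂ] EllTwo Γ) :=
    { carrier := {a | ∀ ξ, a (R ξ) = R (a ξ)}
      zero_mem' := fun ξ => by simp
      add_mem' := fun {a b} ha hb ξ => by
        rw [add_apply, add_apply, ha, hb, map_add]
      smul_mem' := fun c a ha ξ => by
        change c • a (R ξ) = R (c • a ξ)
        rw [ha, map_smul] }
  have hS : IsClosed (S : Set (EllTwo Γ →L[ℂ] EllTwo Γ)) := by
    have : (S : Set (EllTwo Γ →L[ℂ] EllTwo Γ)) = ⋂ ξ, {a | a (R ξ) = R (a ξ)} := by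
      ext a; simp [S]
    rw [this]
    exact isClosed_iInter fun ξ => isClosed_eq (by fun_prop) (by fun_prop)
  exact UnitaryRepr.mem_of_mem_cstarAlgebra (ρ := leftRegularRepr Γ) hS
    (fun g ξ => leftRegularRepr_rightRegularRepr_comm g h ξ) ha ξ

/-- The reduced C⋆-algebra of an icc group is prime. -/
theorem IsICC.exists_apply_ne_zero (hΓ : IsICC Γ) {a b : EllTwo Γ →L[ℂ] EllTwo Γ}
    (ha : a ∈ (leftRegularRepr Γ).cstarAlgebra) (ha0 : a ≠ 0) (hb0 : b ≠ 0) :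
    ∃ g ξ, a (leftRegularRepr Γ g (b ξ)) ≠ 0 := by
  by_contra! h
  -- If `a λ(g) b = 0` for all `g`, this space contains the range of `b`. It is left invariant by
  -- construction and right invariant because `a` commutes with right translations; being trivial or
  -- everything, it forces `b = 0` or `a = 0`.
  let V : Submodule ℂ (EllTwo Γ) :=
    { carrier := {ξ | ∀ g, a (leftRegularRepr Γ g ξ) = 0}
      zero_mem' := fun g => by simp
      add_mem' := fun {x y} hx hy g => by rw [map_add, map_add, hx, hy, add_zero]
      smul_mem' := fun c x hx g => by rw [map_smul, map_smul, hx, smul_zero] }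
  have hV : IsClosed (V : Set (EllTwo Γ)) := by
    have : (V : Set (EllTwo Γ)) = ⋂ g, {ξ | a (leftRegularRepr Γ g ξ) = 0} := by
      ext ξ; simp [V]
    rw [this]
    exact isClosed_iInter fun g =>
      isClosed_eq (a.continuous.comp (leftRegularRepr Γ g).continuous) continuous_const
  have hl : (leftRegularRepr Γ).IsInvariant V := fun h ξ hξ g => by
    have := hξ (g * h)
    rwa [map_mul] at this
  have hr : (rightRegularRepr Γ).IsInvariant V := fun h ξ hξ g => by
    rw [leftRegularRepr_rightRegularRepr_comm, rightRegularRepr_apply_of_mem_cstarAlgebra ha, hξ,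
      map_zero]
  rcases hΓ.eq_bot_or_eq_top hV hl hr with hbot | htop
  · refine hb0 (ContinuousLinearMap.ext fun ξ => ?_)
    have : b ξ ∈ V := fun g => h g ξ
    rw [hbot] at this
    simpa using this
  · refine ha0 (ContinuousLinearMap.ext fun ξ => ?_)
    have : ξ ∈ V := htop ▸ trivial
    have := this 1
    rwa [map_one] at this

end Regular

theorem proposition21 {Γ : Type u} [Group Γ] [Countable Γ] (hΓ : IsICC Γ) :
    UnitaryRepr.IsReducible (leftRegularRepr Γ) ∧
    ∃ (H : Type u) (_ : NormedAddCommGroup H) (_ : InnerProductSpace ℂ H) (_ : CompleteSpace H)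
      (π : UnitaryRepr Γ H),
      UnitaryRepr.IsIrreducible π ∧ UnitaryRepr.WeaklyEquivalent (leftRegularRepr Γ) π := by
  have : Infinite Γ := hΓ.1
  have : Nontrivial (EllTwo Γ) := ⟨pointMass 1, 0, fun h => by
    have := congrArg (fun ξ : EllTwo Γ => ξ 1) h
    simp [pointMass_apply] at this⟩
  exact ⟨isReducible_leftRegularRepr, UnitaryRepr.exists_irreducible_weaklyEquivalent _
    fun a ha b _ ha0 hb0 => hΓ.exists_apply_ne_zero ha ha0 hb0⟩
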